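/- An unlabeled rooted plane tree consists of a root together with a finite (possibly empty) linearly ordered sequence of unlabeled rooted plane trees, whose roots are the children of the root. A leaf is a vertex without children (so the root of the one-vertex tree is a leaf). For an integer $k\ge 0$, a vertex $v$ of such a tree is called $k$-protected if every downward path from $v$ to a leaf has length (number of edges) at least $k$. Let $t_k(n)$ be the total number of $k$-protected vertices in all unlabeled rooted plane trees with $n$ vertices. Then, for every integer $k\ge 0$, $$t_k(n)\sim\frac{3\binom{2n-2}{n-1}}{4^k+2}\qquad (n\to\infty),$$ where $a_n\sim b_n$ means $\lim_{n\to\infty}a_n/b_n=1$. -/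

import Mathlib

/-- Unlabeled rooted plane trees: a root together with the ordered (possibly empty) list of the
plane trees hanging from it. -/
inductive PlaneTree : Type where
  | node (children : List PlaneTree) : PlaneTree

namespace PlaneTree

/-- The ordered list of the subtrees rooted at the children of the root. -/
def children : PlaneTree → List PlaneTree
  | node ts => ts

/-- A list of natural numbers is read as directions for descending from the root: at each step
it tells which child (numbered from the left, starting with `0`) to go to.  The value is the
subtree rooted at the vertex so reached, if there is one. -/
def subtreeAt : PlaneTree → List ℕ → Option PlaneTree
  | t, [] => some t
  | t, i :: p => (t.children[i]?).bind fun s => s.subtreeAt p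

/-- The vertices of a plane tree, each named by the unique directions leading to it from the root.
The root is `[]`, and the children of `v` are the vertices of the form `v ++ [i]`. -/
def vertices (t : PlaneTree) : Set (List ℕ) :=
  {v | (t.subtreeAt v).isSome}

/-- The number of vertices of a plane tree. -/
noncomputable def size (t : PlaneTree) : ℕ :=
  t.vertices.ncard

/-- A leaf is a vertex without children. -/
def IsLeaf (t : PlaneTree) (v : List ℕ) : Prop :=
  v ∈ t.vertices ∧ ∀ i : ℕ, v ++ [i] ∉ t.vertices

/-- A vertex `v` is `k`-protected if every downward path from `v` to a leaf has length at
least `k`.  The downward paths from `v` are given by the directions `p` to follow from `v`; such a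
path ends in `v ++ p` and has length `p.length`. -/
def IsProtected (t : PlaneTree) (k : ℕ) (v : List ℕ) : Prop :=
  v ∈ t.vertices ∧ ∀ p : List ℕ, t.IsLeaf (v ++ p) → k ≤ p.length

/-- The number of `k`-protected vertices of a plane tree. -/
noncomputable def numProtected (t : PlaneTree) (k : ℕ) : ℕ :=
  {v : List ℕ | t.IsProtected k v}.ncard

theorem nil_mem_vertices (t : PlaneTree) : [] ∈ t.vertices := by
  simp [vertices, subtreeAt]

theorem vertices_node (ts : List PlaneTree) :
    (node ts).vertices =
      insert [] (⋃ i : Fin ts.length, List.cons (i : ℕ) '' (ts.get i).vertices) := by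
  ext v
  cases v with
  | nil => simp [vertices, subtreeAt]
  | cons i p =>
    by_cases h : i < ts.length
    · simp only [vertices, subtreeAt, children, Set.mem_ofPred_eq, List.getElem?_eq_getElem h,
        Option.bind_some, Set.mem_insert_iff, Set.mem_iUnion, Set.mem_image, reduceCtorEq,
        false_or, List.cons.injEq]
      constructor
      · intro hp
        exact ⟨⟨i, h⟩, p, hp, rfl, rfl⟩
      · rintro ⟨⟨j, hj⟩, q, hq, h1, h2⟩
        simp only at h1
        subst h1 h2
        exact hq
    · have h0 : ts[i]? = none := List.getElem?_eq_none (not_lt.mp h)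
      simp only [vertices, subtreeAt, children, Set.mem_ofPred_eq, h0, Option.bind_none,
        Option.isSome_none, Bool.false_eq_true, Set.mem_insert_iff, Set.mem_iUnion, Set.mem_image,
        reduceCtorEq, false_or, List.cons.injEq, false_iff]
      rintro ⟨⟨j, hj⟩, q, hq, h1, h2⟩
      exact h (h1 ▸ hj)

/-- A plane tree has finitely many vertices. -/
theorem finite_vertices : ∀ t : PlaneTree, t.vertices.Finite
  | node ts => by
    rw [vertices_node]
    refine Set.Finite.insert _ (Set.finite_iUnion fun i => Set.Finite.image _ ?_)
    exact finite_vertices (ts.get i)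
termination_by t => sizeOf t
decreasing_by
  have h := List.sizeOf_lt_of_mem (List.get_mem ts i)
  simp only [node.sizeOf_spec]
  exact Nat.lt_add_left 1 h

theorem size_node (ts : List PlaneTree) : (node ts).size = (ts.map size).sum + 1 := by
  unfold size
  rw [vertices_node, Set.ncard_insert_of_notMem (by simp)
    (Set.finite_iUnion fun i => (finite_vertices _).image _)]
  congr 1
  have hdisj : Pairwise (Function.onFun Disjoint
      fun i : Fin ts.length => List.cons (i : ℕ) '' (ts.get i).vertices) := by
    intro i j hij
    refine Set.disjoint_left.mpr ?_
    rintro _ ⟨p, -, rfl⟩ ⟨q, -, h⟩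
    exact hij (Fin.ext (List.cons.inj h).1.symm)
  rw [Set.ncard_iUnion_of_finite (fun i => (finite_vertices _).image _) hdisj,
    finsum_eq_sum_of_fintype]
  simp_rw [Set.ncard_image_of_injective _ List.cons_injective]
  rw [← List.sum_ofFn]
  congr 1
  exact List.ext_get (by simp) (by simp)

/-- There are finitely many plane trees with at most `n` vertices. -/
theorem finite_size_le (n : ℕ) : {t : PlaneTree | t.size ≤ n}.Finite := by
  induction n with
  | zero =>
    convert Set.finite_empty
    ext t
    cases t
    simp [size_node]
  | succ n ih =>
    have : Finite {t : PlaneTree | t.size ≤ n} := ih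
    refine ((List.finite_length_le {t : PlaneTree | t.size ≤ n} n).image
      fun l => node (l.map Subtype.val)).subset ?_
    rintro ⟨ts⟩ ht
    have hs : (ts.map size).sum ≤ n := by
      simpa [size_node] using ht
    have hmem : ∀ t ∈ ts, t ∈ {t : PlaneTree | t.size ≤ n} := fun t h =>
      (List.single_le_sum (by simp) _ (List.mem_map_of_mem h)).trans hs
    have hlen : ts.length ≤ n := by
      refine le_trans ?_ hs
      have := List.length_le_sum_of_one_le (ts.map size) (by
        intro i hi
        obtain ⟨⟨us⟩, -, rfl⟩ := List.mem_map.mp hi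
        simp [size_node])
      simpa using this
    refine ⟨ts.attach.map fun t => ⟨t.1, hmem t.1 t.2⟩, by simpa using hlen, ?_⟩
    simp [Function.comp_def]

/-- There are finitely many plane trees with `n` vertices. -/
theorem finite_size_eq (n : ℕ) : {t : PlaneTree | t.size = n}.Finite :=
  (finite_size_le n).subset fun _ h => le_of_eq h

/-- The total number of `k`-protected vertices in all plane trees with `n` vertices. -/
noncomputable def totalProtected (k n : ℕ) : ℕ :=
  ∑ t ∈ (finite_size_eq n).toFinset, t.numProtected k

end PlaneTree

/-!
Every plane tree other than the single vertex splits uniquely into the leftmost subtree `t` of the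
root and the tree `s` that remains (`join t s`), and vertex counts add. Hence, over `ℝ`, the
generating function `T` of all trees satisfies `T = X + T²`; the series `P k` of trees with
`k`-protected root and `A k` of trees whose root has only `k`-protected children satisfy
`A k = X + P k * A k` and `P (k + 1) = P k * A k`; and the series `N k` counting all `k`-protected
vertices satisfies `N k * (1 - 2 T) = P k * (1 - T)` (`protectedGF_mul`).

Differentiating `T = X + T²` shows that `B = T'`, whose coefficients are the central binomial
coefficients, is the inverse of `1 - 2 T`. Therefore `2 N k = P k + P k * B`
(`two_mul_protectedGF`), while `2 T B = B - 1`.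

The coefficients `b n` of `B` satisfy `b (n + 1) / b n → 4`, so the `n`-th coefficient of `P k * B`
should be asymptotic to `P k (1 / 4) * b n`. The domination needed comes from `T`, which bounds
`P k` coefficientwise: by `2 T B = B - 1` the `n`-th coefficient of `T * B` is exactly `b n / 2`, and
`T (1 / 4) = 1 / 2`, so no mass is lost in the limit (`tendsto_convolution`). The functional equations
give `P k (1 / 4) = 3 / (2 * (4 ^ k + 2))` by induction, and the term `P k` alone is negligible, its
coefficients being at most those of `T`, the Catalan numbers.
-/

namespace PlaneTree

open PowerSeries Filter Topology

/-! ### Protected vertices and the children of the root -/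

theorem cons_mem_vertices {ts : List PlaneTree} {i : ℕ} {p : List ℕ} :
    i :: p ∈ (node ts).vertices ↔ ∃ h : i < ts.length, p ∈ ts[i].vertices := by
  by_cases h : i < ts.length
  · simp [vertices, subtreeAt, children, h]
  · simp [vertices, subtreeAt, children, h]

theorem isLeaf_cons {ts : List PlaneTree} {i : ℕ} {p : List ℕ} :
    (node ts).IsLeaf (i :: p) ↔ ∃ h : i < ts.length, ts[i].IsLeaf p := by
  simp only [IsLeaf, List.cons_append, cons_mem_vertices]
  constructor
  · rintro ⟨⟨h, hp⟩, hl⟩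
    exact ⟨h, hp, fun j hj => hl j ⟨h, hj⟩⟩
  · rintro ⟨h, hp, hl⟩
    exact ⟨⟨h, hp⟩, fun j ⟨_, hj⟩ => hl j hj⟩

theorem isLeaf_nil {ts : List PlaneTree} : (node ts).IsLeaf [] ↔ ts = [] := by
  constructor
  · rintro ⟨-, hl⟩
    by_contra hne
    exact hl 0 (cons_mem_vertices.mpr ⟨List.length_pos_iff.mpr hne, nil_mem_vertices _⟩)
  · rintro rfl
    exact ⟨nil_mem_vertices _, fun i hi => by
      obtain ⟨h, -⟩ := cons_mem_vertices.mp hi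
      simp at h⟩

theorem isProtected_cons {ts : List PlaneTree} {k i : ℕ} {v : List ℕ} :
    (node ts).IsProtected k (i :: v) ↔ ∃ h : i < ts.length, ts[i].IsProtected k v := by
  simp only [IsProtected, List.cons_append, cons_mem_vertices, isLeaf_cons]
  constructor
  · rintro ⟨⟨h, hp⟩, hl⟩
    exact ⟨h, hp, fun p hp => hl p ⟨h, hp⟩⟩
  · rintro ⟨h, hp, hl⟩
    exact ⟨⟨h, hp⟩, fun p ⟨_, hp⟩ => hl p hp⟩

theorem isProtected_zero_nil (t : PlaneTree) : t.IsProtected 0 [] :=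
  ⟨nil_mem_vertices t, fun _ _ => Nat.zero_le _⟩

theorem isProtected_succ_nil {ts : List PlaneTree} {k : ℕ} :
    (node ts).IsProtected (k + 1) [] ↔ ts ≠ [] ∧ ∀ s ∈ ts, s.IsProtected k [] := by
  constructor
  · rintro ⟨-, hl⟩
    refine ⟨?_, fun s hs => ?_⟩
    · rintro rfl
      simpa using hl [] (isLeaf_nil.mpr rfl)
    · obtain ⟨i, hi, rfl⟩ := List.getElem_of_mem hs
      exact ⟨nil_mem_vertices _, fun p hp => by
        simpa using hl (i :: p) (isLeaf_cons.mpr ⟨hi, hp⟩)⟩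
  · rintro ⟨hne, hall⟩
    refine ⟨nil_mem_vertices _, fun p hp => ?_⟩
    cases p with
    | nil => exact absurd (isLeaf_nil.mp hp) hne
    | cons i p =>
      obtain ⟨hi, hq⟩ := isLeaf_cons.mp hp
      simpa using (hall _ (List.getElem_mem hi)).2 p hq

open Classical in
theorem numProtected_node (ts : List PlaneTree) (k : ℕ) :
    (node ts).numProtected k =
      (if (node ts).IsProtected k [] then 1 else 0) + (ts.map fun s => s.numProtected k).sum := by
  have hfin (t : PlaneTree) : {v | t.IsProtected k v}.Finite :=
    (finite_vertices t).subset fun _ h => h.1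
  have hset : {v | (node ts).IsProtected k v} =
      (if (node ts).IsProtected k [] then {[]} else ∅) ∪
        ⋃ i : Fin ts.length, List.cons (i : ℕ) '' {v | (ts.get i).IsProtected k v} := by
    ext v
    cases v with
    | nil => by_cases h : (node ts).IsProtected k [] <;> simp [h]
    | cons i p =>
      have : i :: p ∉ (if (node ts).IsProtected k [] then {[]} else ∅ : Set (List ℕ)) := by
        split_ifs <;> simp
      simp only [Set.mem_ofPred_eq, Set.mem_union, this, false_or, isProtected_cons,
        Set.mem_iUnion, Set.mem_image, List.cons.injEq]
      constructor
      · rintro ⟨h, hp⟩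
        exact ⟨⟨i, h⟩, p, hp, rfl, rfl⟩
      · rintro ⟨⟨j, hj⟩, q, hq, rfl, rfl⟩
        exact ⟨hj, hq⟩
  have hdisj : Pairwise (Function.onFun Disjoint
      fun i : Fin ts.length => List.cons (i : ℕ) '' {v | (ts.get i).IsProtected k v}) := by
    intro i j hij
    refine Set.disjoint_left.mpr ?_
    rintro _ ⟨p, -, rfl⟩ ⟨q, -, h⟩
    exact hij (Fin.ext (List.cons.inj h).1.symm)
  unfold numProtected
  rw [hset, Set.ncard_union_eq _ (by split_ifs <;> simp)
    (Set.finite_iUnion fun i => (hfin _).image _),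
    Set.ncard_iUnion_of_finite (fun i => (hfin _).image _) hdisj, finsum_eq_sum_of_fintype]
  · congr 1
    · split_ifs <;> simp
    · simp_rw [Set.ncard_image_of_injective _ List.cons_injective]
      rw [← List.sum_ofFn]
      congr 1
      exact List.ext_get (by simp) (by simp)
  · refine Set.disjoint_left.mpr fun v hv hv' => ?_
    obtain ⟨i, q, -, rfl⟩ := Set.mem_iUnion.mp hv'
    revert hv
    split_ifs <;> simp

/-! ### Generating functions of plane trees -/

/-- The tree obtained from `s` by hanging `t` from its root as a new leftmost child. Every tree
other than the one-vertex tree is `join t s` for a unique pair `(t, s)`. -/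
def join (t s : PlaneTree) : PlaneTree := node (t :: s.children)

theorem size_join (t s : PlaneTree) : (join t s).size = t.size + s.size := by
  cases s
  simp [join, children, size_node, add_assoc]

/-- The power series `∑ f(t) X ^ |t|` over all plane trees `t`, where `|t|` is the number of
vertices. -/
noncomputable def genFun (f : PlaneTree → ℝ) : PowerSeries ℝ :=
  PowerSeries.mk fun n => ∑ t ∈ (finite_size_eq n).toFinset, f t

theorem coeff_genFun (f : PlaneTree → ℝ) (n : ℕ) :
    coeff n (genFun f) = ∑ t ∈ (finite_size_eq n).toFinset, f t := by
  simp [genFun]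

theorem genFun_zero : genFun (fun _ => 0) = 0 := by
  ext n
  simp [coeff_genFun]

theorem genFun_add (f g : PlaneTree → ℝ) : genFun (fun t => f t + g t) = genFun f + genFun g := by
  ext n
  simp [coeff_genFun, Finset.sum_add_distrib]

theorem coeff_zero_genFun (f : PlaneTree → ℝ) : coeff 0 (genFun f) = 0 := by
  rw [coeff_genFun]
  refine Finset.sum_eq_zero fun t ht => ?_
  cases t
  simp [size_node] at ht

theorem coeff_genFun_nonneg {f : PlaneTree → ℝ} (hf : ∀ t, 0 ≤ f t) (n : ℕ) :
    0 ≤ coeff n (genFun f) := by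
  rw [coeff_genFun]
  exact Finset.sum_nonneg fun t _ => hf t

theorem coeff_genFun_mono {f g : PlaneTree → ℝ} (h : ∀ t, f t ≤ g t) (n : ℕ) :
    coeff n (genFun f) ≤ coeff n (genFun g) := by
  simp only [coeff_genFun]
  exact Finset.sum_le_sum fun t _ => h t

open Classical in
/-- A product of generating functions, read along the bijection `join` from pairs of trees to the
trees other than the single vertex. The junk value of `headD` is never used, since the single
vertex is erased. -/
theorem coeff_genFun_mul (f g : PlaneTree → ℝ) (n : ℕ) :
    coeff n (genFun f * genFun g) =
      ∑ t ∈ (finite_size_eq n).toFinset.erase (node []),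
        f (t.children.headD (node [])) * g (node t.children.tail) := by
  rw [coeff_mul]
  simp only [coeff_genFun, Finset.sum_mul_sum, ← Finset.sum_product']
  rw [Finset.sum_sigma']
  refine Finset.sum_bij' (fun x _ => join x.2.1 x.2.2)
    (fun t _ => ⟨((t.children.headD (node [])).size, (node t.children.tail).size),
      (t.children.headD (node []), node t.children.tail)⟩) ?_ ?_ ?_ ?_ ?_
  · rintro ⟨⟨i, j⟩, t, s⟩ h
    simp only [Finset.mem_sigma, Finset.HasAntidiagonal.mem_antidiagonal, Finset.mem_product,
      Set.Finite.mem_toFinset, Set.mem_ofPred_eq] at h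
    have hne : join t s ≠ node [] := by simp [join]
    simpa [size_join, h.2.1, h.2.2, hne] using h.1
  · rintro ⟨_ | ⟨t, ts⟩⟩ h
    · simp at h
    · have : (node (t :: ts)).size = n := by simpa using h
      simp [children, ← this, size_node, add_assoc]
  · rintro ⟨⟨i, j⟩, t, ⟨ts⟩⟩ h
    simp only [Finset.mem_sigma, Finset.HasAntidiagonal.mem_antidiagonal, Finset.mem_product,
      Set.Finite.mem_toFinset, Set.mem_ofPred_eq] at h
    obtain ⟨-, rfl, rfl⟩ := h
    simp [join, children]
  · rintro ⟨_ | ⟨t, ts⟩⟩ h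
    · simp at h
    · simp [children, join]
  · rintro ⟨⟨i, j⟩, t, ⟨ts⟩⟩ h
    simp [join, children]

/-- A recursion for `f` along `join` becomes a functional equation for `genFun f`; the first term
is the contribution of the one-vertex tree. -/
theorem genFun_eq_of_join {f g₁ h₁ g₂ h₂ : PlaneTree → ℝ}
    (hj : ∀ t s, f (join t s) = g₁ t * h₁ s + g₂ t * h₂ s) :
    genFun f = C (f (node [])) * X + genFun g₁ * genFun h₁ + genFun g₂ * genFun h₂ := by
  classical
  ext n
  have hleaf : node [] ∈ (finite_size_eq n).toFinset ↔ n = 1 := by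
    simp [size_node, eq_comm]
  have hsum : ∑ t ∈ (finite_size_eq n).toFinset.erase (node []), f t =
      coeff n (genFun g₁ * genFun h₁) + coeff n (genFun g₂ * genFun h₂) := by
    rw [coeff_genFun_mul, coeff_genFun_mul, ← Finset.sum_add_distrib]
    refine Finset.sum_congr rfl ?_
    rintro ⟨_ | ⟨t, ts⟩⟩ h
    · simp at h
    · exact hj t (node ts)
  rw [map_add, map_add, add_assoc, ← hsum, coeff_genFun, coeff_C_mul, coeff_X]
  split_ifs with hn
  · rw [mul_one, Finset.add_sum_erase _ _ (hleaf.mpr hn)]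
  · rw [Finset.erase_eq_of_notMem (mt hleaf.mp hn), mul_zero, zero_add]

/-! ### Functional equations -/

/-- The generating function of all plane trees. -/
noncomputable def treeGF : PowerSeries ℝ := genFun fun _ => 1

open Classical in
/-- The generating function of the plane trees whose root is `k`-protected. -/
noncomputable def rootProtectedGF (k : ℕ) : PowerSeries ℝ :=
  genFun fun t => if t.IsProtected k [] then 1 else 0

open Classical in
/-- The generating function of the plane trees in which every child of the root is
`k`-protected; the one-vertex tree is among them. -/
noncomputable def childrenProtectedGF (k : ℕ) : PowerSeries ℝ :=
  genFun fun t => if ∀ s ∈ t.children, s.IsProtected k [] then 1 else 0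

/-- The generating function of `totalProtected k`. -/
noncomputable def protectedGF (k : ℕ) : PowerSeries ℝ :=
  genFun fun t => (t.numProtected k : ℝ)

theorem coeff_protectedGF (k n : ℕ) : coeff n (protectedGF k) = totalProtected k n := by
  simp [protectedGF, coeff_genFun, totalProtected]

theorem rootProtectedGF_zero : rootProtectedGF 0 = treeGF := by
  simp [rootProtectedGF, treeGF, isProtected_zero_nil]

theorem treeGF_eq : treeGF = X + treeGF * treeGF := by
  have h := genFun_eq_of_join (f := fun _ => 1) (g₁ := fun _ => 1) (h₁ := fun _ => 1)
    (g₂ := fun _ => 0) (h₂ := fun _ => 0) (by simp)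
  simpa [genFun_zero, treeGF] using h

theorem childrenProtectedGF_eq (k : ℕ) :
    childrenProtectedGF k = X + rootProtectedGF k * childrenProtectedGF k := by
  classical
  have h := genFun_eq_of_join
    (f := fun t => if ∀ s ∈ t.children, s.IsProtected k [] then 1 else 0)
    (g₁ := fun t => if t.IsProtected k [] then 1 else 0)
    (h₁ := fun t => if ∀ s ∈ t.children, s.IsProtected k [] then 1 else 0)
    (g₂ := fun _ => 0) (h₂ := fun _ => 0) (by
      intro t s
      by_cases h : t.IsProtected k []
      · simp [join, children, h]
        congr
      · simp [join, children, h])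
  simpa [genFun_zero, childrenProtectedGF, rootProtectedGF, children] using h

theorem rootProtectedGF_succ (k : ℕ) :
    rootProtectedGF (k + 1) = rootProtectedGF k * childrenProtectedGF k := by
  classical
  have h := genFun_eq_of_join
    (f := fun t => if t.IsProtected (k + 1) [] then 1 else 0)
    (g₁ := fun t => if t.IsProtected k [] then 1 else 0)
    (h₁ := fun t => if ∀ s ∈ t.children, s.IsProtected k [] then 1 else 0)
    (g₂ := fun _ => 0) (h₂ := fun _ => 0) (by
      intro t s
      cases s
      by_cases h : t.IsProtected k []
      · simp [join, children, isProtected_succ_nil, h]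
        congr
      · simp [join, children, isProtected_succ_nil, h])
  simpa [genFun_zero, childrenProtectedGF, rootProtectedGF, isProtected_succ_nil, children] using h

theorem protectedGF_mul (k : ℕ) :
    protectedGF k * (1 - 2 * treeGF) = rootProtectedGF k * (1 - treeGF) := by
  classical
  -- `M` counts the protected vertices other than the root
  set M : PowerSeries ℝ :=
    genFun fun t => ((t.children.map fun s => s.numProtected k).sum : ℝ) with hM
  have h1 : protectedGF k = rootProtectedGF k + M := by
    rw [hM, rootProtectedGF, ← genFun_add, protectedGF]
    congr 1
    funext ⟨ts⟩
    rw [numProtected_node]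
    push_cast
    simp [children, Function.comp_def]
  have h2 : M = protectedGF k * treeGF + treeGF * M := by
    have h := genFun_eq_of_join
      (f := fun t => ((t.children.map fun s => s.numProtected k).sum : ℝ))
      (g₁ := fun t => (t.numProtected k : ℝ)) (h₁ := fun _ => 1) (g₂ := fun _ => 1)
      (h₂ := fun t => ((t.children.map fun s => s.numProtected k).sum : ℝ)) (by
        intro t s
        simp [join, children])
    simpa [children, protectedGF, treeGF, M] using h
  linear_combination (1 - treeGF) * h1 + h2

/-! ### Central binomial coefficients -/

/-- Both sides are roots of `Y = X + Y ^ 2` with vanishing constant term, which determines the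
root. -/
theorem treeGF_eq_X_mul_catalan :
    treeGF = X * (catalanSeries.map (Nat.castRingHom ℝ)) := by
  set c := catalanSeries.map (Nat.castRingHom ℝ) with hc
  have h : c ^ 2 * X + 1 = c := by
    have := congrArg (PowerSeries.map (Nat.castRingHom ℝ)) catalanSeries_sq_mul_X_add_one
    simpa [hc] using this
  have hmul : (treeGF - X * c) * (1 - treeGF - X * c) = 0 := by
    linear_combination treeGF_eq + X * h
  -- the second factor has constant term `1`, so it is not zero
  refine sub_eq_zero.mp ((mul_eq_zero.mp hmul).resolve_right fun h0 => ?_)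
  have := congrArg (coeff 0) h0
  have ht : coeff 0 treeGF = 0 := coeff_zero_genFun _
  simp only [coeff_zero_eq_constantCoeff] at ht
  simp [ht] at this

theorem coeff_succ_treeGF (n : ℕ) :
    coeff (n + 1) treeGF = (n.centralBinom : ℝ) / (n + 1) := by
  rw [treeGF_eq_X_mul_catalan, coeff_succ_X_mul, coeff_map, catalanSeries_coeff,
    eq_div_iff (by positivity), ← succ_mul_catalan_eq_centralBinom]
  simp [mul_comm]

/-- The generating function of the central binomial coefficients. -/
noncomputable def centralBinomGF : PowerSeries ℝ := PowerSeries.mk fun n => (n.centralBinom : ℝ)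

theorem derivative_treeGF : d⁄dX ℝ treeGF = centralBinomGF := by
  ext n
  rw [coeff_derivative, coeff_succ_treeGF, centralBinomGF, coeff_mk]
  field_simp

theorem centralBinomGF_mul : centralBinomGF * (1 - 2 * treeGF) = 1 := by
  have h := congrArg (d⁄dX ℝ) treeGF_eq
  rw [map_add, Derivation.leibniz, derivative_treeGF, derivative_X, smul_eq_mul] at h
  linear_combination h

theorem two_mul_protectedGF (k : ℕ) :
    2 * protectedGF k = rootProtectedGF k + rootProtectedGF k * centralBinomGF := by
  linear_combination 2 * centralBinomGF * protectedGF_mul k +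
    (rootProtectedGF k - 2 * protectedGF k) * centralBinomGF_mul

/-! ### Values at the dominant singularity `1 / 4` -/

theorem rootProtectedGF_nonneg (k n : ℕ) : 0 ≤ coeff n (rootProtectedGF k) :=
  coeff_genFun_nonneg (fun t => by split_ifs <;> simp) n

theorem childrenProtectedGF_nonneg (k n : ℕ) : 0 ≤ coeff n (childrenProtectedGF k) :=
  coeff_genFun_nonneg (fun t => by split_ifs <;> simp) n

theorem rootProtectedGF_le (k n : ℕ) : coeff n (rootProtectedGF k) ≤ coeff n treeGF :=
  coeff_genFun_mono (fun t => by split_ifs <;> simp) n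

theorem childrenProtectedGF_le (k n : ℕ) : coeff n (childrenProtectedGF k) ≤ coeff n treeGF :=
  coeff_genFun_mono (fun t => by split_ifs <;> simp) n

theorem treeGF_nonneg (n : ℕ) : 0 ≤ coeff n treeGF :=
  coeff_genFun_nonneg (fun _ => zero_le_one) n

theorem sum_treeGF_mul_centralBinom {n : ℕ} (hn : n ≠ 0) :
    ∑ i ∈ Finset.range (n + 1), coeff i treeGF * ((n - i).centralBinom : ℝ) =
      n.centralBinom / 2 := by
  have h : 2 * (treeGF * centralBinomGF) = centralBinomGF - 1 := by
    linear_combination - centralBinomGF_mul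
  have h' := congrArg (coeff n) h
  rw [two_mul, map_add, map_sub, coeff_mul, coeff_one, if_neg hn,
    Finset.Nat.sum_antidiagonal_eq_sum_range_succ
      fun i j => coeff i treeGF * coeff j centralBinomGF] at h'
  simp only [centralBinomGF, coeff_mk] at h'
  linarith

theorem tendsto_centralBinom_succ_div :
    Tendsto (fun n : ℕ => ((n + 1).centralBinom : ℝ) / n.centralBinom) atTop (𝓝 4) := by
  have h : ∀ n : ℕ, ((n + 1).centralBinom : ℝ) / n.centralBinom = 4 - 2 * (1 / ((n : ℝ) + 1)) := by
    intro n
    have hb : (n.centralBinom : ℝ) ≠ 0 := by exact_mod_cast n.centralBinom_ne_zero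
    have hs : ((n : ℝ) + 1) * (n + 1).centralBinom = 2 * (2 * n + 1) * n.centralBinom := by
      exact_mod_cast n.succ_mul_centralBinom_succ
    field_simp
    linear_combination hs
  simp_rw [h]
  simpa using (tendsto_one_div_add_atTop_nhds_zero_nat (𝕜 := ℝ)).const_mul 2 |>.const_sub 4

theorem tendsto_centralBinom_sub_div (i : ℕ) :
    Tendsto (fun n : ℕ => ((n - i).centralBinom : ℝ) / n.centralBinom) atTop
      (𝓝 (1 / 4 ^ i)) := by
  rw [← tendsto_add_atTop_iff_nat i]
  simp only [Nat.add_sub_cancel]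
  induction i with
  | zero =>
    refine tendsto_const_nhds.congr fun n => ?_
    have hb : (n.centralBinom : ℝ) ≠ 0 := by exact_mod_cast n.centralBinom_ne_zero
    simp [hb]
  | succ i ih =>
    have h := ih.mul
      ((tendsto_centralBinom_succ_div.comp (tendsto_add_atTop_nat i)).inv₀ (by norm_num))
    rw [show (1 : ℝ) / 4 ^ (i + 1) = 1 / 4 ^ i * 4⁻¹ by rw [pow_succ]; field_simp]
    refine h.congr fun n => ?_
    have hb : ((n + i).centralBinom : ℝ) ≠ 0 := by exact_mod_cast (n + i).centralBinom_ne_zero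
    simp only [Function.comp_apply, inv_div, ← add_assoc]
    field_simp

/-- A finite partial sum of `∑ p i / 4 ^ i` is the limit of the corresponding part of the
convolution of `p` with the central binomial coefficients. -/
theorem tendsto_partial_convolution (p : ℕ → ℝ) (J : ℕ) :
    Tendsto (fun n : ℕ => (∑ i ∈ Finset.range J, p i * ((n - i).centralBinom : ℝ)) /
      n.centralBinom) atTop (𝓝 (∑ i ∈ Finset.range J, p i / 4 ^ i)) := by
  simp only [Finset.sum_div, mul_div_assoc]
  refine tendsto_finsetSum _ fun i _ => ?_
  simpa [div_eq_mul_inv] using (tendsto_centralBinom_sub_div i).const_mul (p i)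

theorem partial_convolution_le {p : ℕ → ℝ} (hp : ∀ i, 0 ≤ p i) {J n : ℕ} (h : J ≤ n) :
    (∑ i ∈ Finset.range J, p i * ((n - i).centralBinom : ℝ)) / n.centralBinom ≤
      (∑ i ∈ Finset.range (n + 1), p i * ((n - i).centralBinom : ℝ)) / n.centralBinom := by
  gcongr
  · intro i _ _
    exact mul_nonneg (hp i) (Nat.cast_nonneg _)
  · omega

theorem convolution_treeGF_div {n : ℕ} (hn : n ≠ 0) :
    (∑ i ∈ Finset.range (n + 1), coeff i treeGF * ((n - i).centralBinom : ℝ)) /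
      n.centralBinom = 1 / 2 := by
  have hb : (n.centralBinom : ℝ) ≠ 0 := by exact_mod_cast n.centralBinom_ne_zero
  rw [sum_treeGF_mul_centralBinom hn]
  field_simp

/-- The partial sums are limits of partial convolutions, each at most `1 / 2`. -/
theorem summable_treeGF : Summable fun i => coeff i treeGF / (4 : ℝ) ^ i := by
  refine summable_of_sum_range_le (c := 1 / 2)
    (fun i => div_nonneg (treeGF_nonneg i) (by positivity)) fun J => ?_
  refine le_of_tendsto (tendsto_partial_convolution (fun i => coeff i treeGF) J) ?_
  filter_upwards [eventually_ge_atTop J, eventually_ne_atTop 0] with n hJ hn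
  exact (partial_convolution_le treeGF_nonneg hJ).trans_eq (convolution_treeGF_div hn)

theorem summable_of_le_treeGF {F : PowerSeries ℝ} (h0 : ∀ n, 0 ≤ coeff n F)
    (h : ∀ n, coeff n F ≤ coeff n treeGF) : Summable fun i => coeff i F / (4 : ℝ) ^ i :=
  summable_treeGF.of_nonneg_of_le (fun i => div_nonneg (h0 i) (by positivity))
    fun i => by gcongr; exact h i

/-- The value of a power series at `1 / 4`; it is `0` if the series is not summable there. -/
noncomputable def evalQuarter (F : PowerSeries ℝ) : ℝ := ∑' i, coeff i F / 4 ^ i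

theorem evalQuarter_X_add_mul {F G : PowerSeries ℝ} (hF0 : ∀ n, 0 ≤ coeff n F)
    (hF : ∀ n, coeff n F ≤ coeff n treeGF) (hG0 : ∀ n, 0 ≤ coeff n G)
    (hG : ∀ n, coeff n G ≤ coeff n treeGF) :
    evalQuarter (F * G) = evalQuarter F * evalQuarter G ∧
      evalQuarter (X + F * G) = 1 / 4 + evalQuarter F * evalQuarter G := by
  have hconv : ∀ n, ∑ q ∈ Finset.HasAntidiagonal.antidiagonal n,
      coeff q.1 F / (4 : ℝ) ^ q.1 * (coeff q.2 G / 4 ^ q.2) = coeff n (F * G) / 4 ^ n := by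
    intro n
    rw [coeff_mul, Finset.sum_div]
    refine Finset.sum_congr rfl fun q hq => ?_
    rw [← Finset.HasAntidiagonal.mem_antidiagonal.mp hq, pow_add, div_mul_div_comm]
  have sF := (summable_of_le_treeGF hF0 hF).norm
  have sG := (summable_of_le_treeGF hG0 hG).norm
  have sFG := (summable_norm_sum_mul_antidiagonal_of_summable_norm sF sG).of_norm
  have hmul : evalQuarter (F * G) = evalQuarter F * evalQuarter G := by
    unfold evalQuarter
    rw [tsum_mul_tsum_eq_tsum_sum_antidiagonal_of_summable_norm sF sG]
    simp_rw [hconv]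
  refine ⟨hmul, ?_⟩
  simp_rw [hconv] at sFG
  have hX : HasSum (fun i => coeff i (X : PowerSeries ℝ) / (4 : ℝ) ^ i) (1 / 4) := by
    convert hasSum_single 1 (f := fun i => coeff i (X : PowerSeries ℝ) / (4 : ℝ) ^ i) ?_ using 1
    · simp
    · intro i hi
      simp [coeff_X, hi]
  rw [← hmul]
  unfold evalQuarter
  rw [← (hX.add sFG.hasSum).tsum_eq]
  simp [add_div]

/-- At `1 / 4` the equation `T = X + T ^ 2` becomes `(T - 1 / 2) ^ 2 = 0`. -/
theorem evalQuarter_treeGF : evalQuarter treeGF = 1 / 2 := by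
  have h := (evalQuarter_X_add_mul treeGF_nonneg (fun _ => le_rfl) treeGF_nonneg
    (fun _ => le_rfl)).2
  rw [← treeGF_eq] at h
  have : (evalQuarter treeGF - 1 / 2) ^ 2 = 0 := by linear_combination - h
  exact sub_eq_zero.mp (pow_eq_zero_iff two_ne_zero |>.mp this)

theorem evalQuarter_rootProtectedGF (k : ℕ) :
    evalQuarter (rootProtectedGF k) = 3 / (2 * (4 ^ k + 2)) := by
  induction k with
  | zero => rw [rootProtectedGF_zero, evalQuarter_treeGF]; norm_num
  | succ k ih =>
    obtain ⟨h1, h2⟩ := evalQuarter_X_add_mul (rootProtectedGF_nonneg k) (rootProtectedGF_le k)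
      (childrenProtectedGF_nonneg k) (childrenProtectedGF_le k)
    rw [← childrenProtectedGF_eq, ih] at h2
    rw [rootProtectedGF_succ, h1, ih]
    have hk : (0 : ℝ) < 4 ^ k := by positivity
    have ha : evalQuarter (childrenProtectedGF k) = (4 ^ k + 2) / (2 * (2 * 4 ^ k + 1)) := by
      rw [eq_div_iff (by positivity)]
      field_simp at h2
      linear_combination h2 / 2
    rw [ha, pow_succ]
    field_simp
    ring

/-! ### Transfer to coefficients -/

/-- Fatou's lemma for the convolution with the central binomial coefficients. -/
theorem eventually_lt_convolution {p : ℕ → ℝ} (hp : ∀ i, 0 ≤ p i)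
    (hs : Summable fun i => p i / (4 : ℝ) ^ i) {a : ℝ} (ha : a < ∑' i, p i / (4 : ℝ) ^ i) :
    ∀ᶠ n : ℕ in atTop, a < (∑ i ∈ Finset.range (n + 1), p i * ((n - i).centralBinom : ℝ)) /
      n.centralBinom := by
  obtain ⟨J, hJ⟩ := (hs.hasSum.tendsto_sum_nat.eventually_const_lt ha).exists
  filter_upwards [(tendsto_partial_convolution p J).eventually_const_lt hJ,
    eventually_ge_atTop J] with n h hn
  exact h.trans_le (partial_convolution_le hp hn)

/-- Dominated convergence for the convolution with the central binomial coefficients. The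
dominating series is `treeGF`, for which the normalized convolution equals its limit `1 / 2`
exactly; so Fatou's lemma for `F` and for `treeGF - F` gives both bounds. -/
theorem tendsto_convolution {F : PowerSeries ℝ} (h0 : ∀ n, 0 ≤ coeff n F)
    (h : ∀ n, coeff n F ≤ coeff n treeGF) :
    Tendsto (fun n : ℕ => (∑ i ∈ Finset.range (n + 1), coeff i F * ((n - i).centralBinom : ℝ)) /
      n.centralBinom) atTop (𝓝 (evalQuarter F)) := by
  have hs := summable_of_le_treeGF h0 h
  refine tendsto_order.mpr ⟨fun a ha => eventually_lt_convolution h0 hs ha, fun a ha => ?_⟩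
  have hd : ∑' i, (coeff i treeGF - coeff i F) / (4 : ℝ) ^ i = 1 / 2 - evalQuarter F := by
    simp_rw [sub_div]
    rw [summable_treeGF.tsum_sub hs, ← evalQuarter_treeGF]
    rfl
  have hsd : Summable fun i => (coeff i treeGF - coeff i F) / (4 : ℝ) ^ i := by
    simp_rw [sub_div]
    exact summable_treeGF.sub hs
  filter_upwards [eventually_lt_convolution (fun i => sub_nonneg.mpr (h i)) hsd
    (a := 1 / 2 - a) (by rw [hd]; linarith), eventually_ne_atTop 0] with n hn hn0
  simp_rw [sub_mul] at hn
  rw [Finset.sum_sub_distrib, sub_div, convolution_treeGF_div hn0] at hn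
  linarith

theorem tendsto_totalProtected (k : ℕ) :
    Tendsto (fun n : ℕ => (totalProtected k (n + 1) : ℝ) / n.centralBinom) atTop
      (𝓝 (3 / (4 ^ k + 2))) := by
  have hroot : Tendsto (fun n : ℕ => coeff (n + 1) (rootProtectedGF k) / n.centralBinom) atTop
      (𝓝 0) := by
    refine squeeze_zero (fun n => div_nonneg (rootProtectedGF_nonneg k _) (Nat.cast_nonneg _))
      (fun n => ?_) (tendsto_one_div_add_atTop_nhds_zero_nat (𝕜 := ℝ))
    have hb : (0 : ℝ) < n.centralBinom := by exact_mod_cast n.centralBinom_pos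
    rw [div_le_iff₀ hb, one_div_mul_eq_div, ← coeff_succ_treeGF]
    exact rootProtectedGF_le k (n + 1)
  have hconv := (tendsto_convolution (rootProtectedGF_nonneg k) (rootProtectedGF_le k)).comp
    (tendsto_add_atTop_nat 1)
  have h := (hroot.add (hconv.mul tendsto_centralBinom_succ_div)).div_const 2
  rw [evalQuarter_rootProtectedGF] at h
  rw [show (3 : ℝ) / (4 ^ k + 2) = (0 + 3 / (2 * (4 ^ k + 2)) * 4) / 2 by field_simp; ring]
  refine h.congr fun n => ?_
  have hb : (n.centralBinom : ℝ) ≠ 0 := by exact_mod_cast n.centralBinom_ne_zero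
  have hb' : ((n + 1).centralBinom : ℝ) ≠ 0 := by exact_mod_cast (n + 1).centralBinom_ne_zero
  have h2 := congrArg (coeff (n + 1)) (two_mul_protectedGF k)
  rw [two_mul, map_add, map_add, coeff_protectedGF, coeff_mul,
    Finset.Nat.sum_antidiagonal_eq_sum_range_succ
      fun i j => coeff i (rootProtectedGF k) * coeff j centralBinomGF] at h2
  simp only [centralBinomGF, coeff_mk] at h2
  simp only [Function.comp_apply]
  field_simp
  linear_combination - h2

end PlaneTree

theorem theorem3 (k : ℕ) :
    Filter.Tendsto
      (fun n : ℕ => (PlaneTree.totalProtected k n : ℝ) /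
        (3 * (Nat.choose (2 * n - 2) (n - 1) : ℝ) / ((4 : ℝ) ^ k + 2)))
      Filter.atTop (nhds 1) := by
  rw [← Filter.tendsto_add_atTop_iff_nat 1]
  have hk : (0 : ℝ) < 4 ^ k + 2 := by positivity
  have h := (PlaneTree.tendsto_totalProtected k).div_const (3 / (4 ^ k + 2))
  rw [div_self (by positivity)] at h
  refine h.congr fun n => ?_
  rw [div_div, Nat.add_sub_cancel, show 2 * (n + 1) - 2 = 2 * n by omega,
    ← Nat.centralBinom_eq_two_mul_choose]
  congr 1
  ring
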